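/- A weighted graph $G$ on the node set $V=\{1,\dots,n\}$ with weights in $\{-1,1\}$ assigns a weight $w_{uv}\in\{-1,1\}$ to every pair $\{u,v\}$ of distinct nodes. For a partition $\mathcal C$ of $V$ into any number of clusters, $\mathrm{disagree}(G,\mathcal C)$ is the number of edges of weight $1$ whose end-points lie in different clusters plus the number of edges of weight $-1$ whose end-points lie in the same cluster, and $\mathrm{min\text{-}disagree}(G)=\min_{\mathcal C}\mathrm{disagree}(G,\mathcal C)$. A stream that presents $G$ is a list in which each of the $\binom n2$ edges occurs exactly once, in an arbitrary order, together with its weight. A randomized $p$-pass streaming algorithm with $s$ bits of memory reads such a stream $p$ times from beginning to end and then answers yes or no; nothing but the content of its $s$-bit memory is carried over from one item of the stream, or one pass, to the next. (The algorithm may depend on $n$; its computation on each item is unrestricted and may use the pass number, the position in the stream and the outcome of its coin flips, none of which is charged as space.) **Theorem.** There are absolute constants $c>0$ and $N$ such that for all $n\ge N$, all $p\ge 1$ and all $s\ge 0$: if some randomized $p$-pass streaming algorithm with $s$ bits of memory decides, on every stream that presents a graph $G$ on $n$ nodes with weights in $\{-1,1\}$, whether $\mathrm{min\text{-}disagree}(G)=0$,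 with a correct answer with probability at least $9/10$, then $s\ge c\,n/p$. In other words, any $p$-pass streaming algorithm for this test needs $\Omega(n/p)$ bits. -/

import Mathlib

/-! ## Correlation clustering -/

/-- The edges of the complete graph on the node set `{0, …, n - 1}`: unordered pairs of distinct
nodes. A weighted graph `G` on `n` nodes is a function `w : KEdge n → ℤ`. -/
abbrev KEdge (n : ℕ) : Type := {e : Sym2 (Fin n) // ¬ e.IsDiag}

/-- A node-partition into (nonempty, pairwise disjoint) clusters, of any number. -/
abbrev Clustering (n : ℕ) : Type := Finpartition (Finset.univ : Finset (Fin n))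

/-- Both end-points of `e` lie in one cluster of `C`. -/
def SameCluster {n : ℕ} (C : Clustering n) (e : KEdge n) : Prop :=
  ∃ P ∈ C.parts, ∀ v ∈ e.1, v ∈ P

/-- The edge `e` agrees with `C`: a positive edge has its end-points in one cluster, a negative
edge has them in different clusters. (Edges of weight zero contribute nothing either way.) -/
def EdgeAgrees {n : ℕ} (w : KEdge n → ℤ) (C : Clustering n) (e : KEdge n) : Prop :=
  (0 < w e ∧ SameCluster C e) ∨ (w e < 0 ∧ ¬ SameCluster C e)

open Classical in
/-- `agree(G, C)`: the sum of `|w_e|` over the edges `e` that agree with `C`. -/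
noncomputable def agree {n : ℕ} (w : KEdge n → ℤ) (C : Clustering n) : ℤ :=
  ∑ e ∈ (Finset.univ : Finset (KEdge n)).filter (fun e => EdgeAgrees w C e), |w e|

/-- `disagree(G, C) = ∑_e |w_e| - agree(G, C)`. -/
noncomputable def disagree {n : ℕ} (w : KEdge n → ℤ) (C : Clustering n) : ℤ :=
  (∑ e : KEdge n, |w e|) - agree w C

/-- `min-disagree(G)`: the minimum of `disagree(G, C)` over all node-partitions `C`. -/
noncomputable def minDisagree {n : ℕ} (w : KEdge n → ℤ) : ℤ :=
  ⨅ C : Clustering n, disagree w C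

theorem disagree_nonneg {n : ℕ} (w : KEdge n → ℤ) (C : Clustering n) : 0 ≤ disagree w C := by
  classical
  unfold disagree agree
  exact sub_nonneg.2 (Finset.sum_le_sum_of_subset_of_nonneg (Finset.filter_subset _ _)
    (fun e _ _ => abs_nonneg (w e)))

/-- The infimum in the definition of `minDisagree` is an attained minimum. -/
theorem minDisagree_isLeast {n : ℕ} (w : KEdge n → ℤ) :
    IsLeast (Set.range (disagree w)) (minDisagree w) := by
  have hb : BddBelow (Set.range (disagree w)) :=
    ⟨0, by rintro _ ⟨C, rfl⟩; exact disagree_nonneg w C⟩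
  have hne : (Set.range (disagree w)).Nonempty := ⟨_, (⊥ : Clustering n), rfl⟩
  exact ⟨Int.csInf_mem hne hb, fun x hx => csInf_le hb hx⟩

/-! ## Multi-pass streaming algorithms -/

/-- The content of a memory of `s` bits. -/
abbrev Memory (s : ℕ) : Type := Fin s → Bool

/-- A streaming algorithm that makes `p` passes over a stream of items from `α`, uses `s` bits of
memory and answers yes or no, with its coin flips fixed. Nothing but the `s` bits is carried over
from one item to the next and from one pass to the next. How the memory changes on reading an item
may depend on the pass and on the position in the stream, and is otherwise an arbitrary function
of memory content and item: neither time nor workspace between two items is limited. -/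
structure StreamAlg (p s : ℕ) (α : Type) where
  init : Memory s
  update : Fin p → ℕ → Memory s → α → Memory s
  output : Memory s → Bool

namespace StreamAlg

variable {p s : ℕ} {α : Type}

/-- Pass number `i` over the stream `σ`, started with memory content `m`. -/
def runPass (A : StreamAlg p s α) (σ : List α) (m : Memory s) (i : Fin p) : Memory s :=
  σ.zipIdx.foldl (fun m' x => A.update i x.2 m' x.1) m

/-- The answer after the `p` passes over the stream `σ`. -/
def run (A : StreamAlg p s α) (σ : List α) : Bool :=
  A.output ((List.finRange p).foldl (A.runPass σ) A.init)

end StreamAlg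

/-- `σ` is a stream that presents the weighted graph `w`: every edge of the complete graph occurs
exactly once, together with its weight, in some order. -/
def IsStreamOf {n : ℕ} (σ : List (KEdge n × ℤ)) (w : KEdge n → ℤ) : Prop :=
  ∃ l : List (KEdge n), l.Nodup ∧ (∀ e, e ∈ l) ∧ σ = l.map (fun e => (e, w e))

/-- A randomized `p`-pass streaming algorithm with `s` bits of memory, given as a family of
algorithms `A ω` indexed by the outcome `ω` of all its coin flips (distributed by `μ`; access to
them is not charged), tests with probability at least `9/10` whether `min-disagree(G) = 0`, for
graphs `G` on `n` nodes with all weights in `{-1, 1}`: its answer is a random variable, and on every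
stream that presents such a graph the answer is right with probability at least `9/10`. -/
def TestsMinDisagreeZero {n p s : ℕ} {Ω : Type*} [MeasurableSpace Ω]
    (μ : MeasureTheory.Measure Ω) (A : Ω → StreamAlg p s (KEdge n × ℤ)) : Prop :=
  (∀ σ : List (KEdge n × ℤ), Measurable (fun ω => (A ω).run σ)) ∧
  ∀ (w : KEdge n → ℤ) (σ : List (KEdge n × ℤ)),
    (∀ e, w e = -1 ∨ w e = 1) → IsStreamOf σ w →
      9 / 10 ≤ μ.real {ω | (A ω).run σ = true ↔ minDisagree w = 0}

/-!
The test is at least as hard as set disjointness. Given sets `x` and `y` held by two parties, take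
disjoint triples of nodes `a i, b i, c i`, join `a i, c i` positively for `i ∈ x` and `b i, c i`
positively for `i ∈ y`, and make all other edges negative. Since `a i, b i` is negative, this graph
is a union of positive cliques if and only if `x` and `y` are disjoint
(`minDisagree_tripleGraph_eq_zero_iff`). The stream can list the edges whose weights depend on `y`
last, so that a `p`-pass algorithm with `s` bits becomes a protocol with `2 p` messages of `s` bits
(`exp_le_of_testsMinDisagreeZero`).

The linear lower bound for disjointness follows Razborov. A ground set of `2 m + 1` points is split
at random into a point `i` and two `m`-sets `T` and `T'`; a disjoint pair is drawn as a subset of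
`T` and a subset of `T'`, and an intersecting pair by adding `i` to both. The first party sees only
subsets of `T ∪ {i}`, in which `i` is a uniformly random point. If the family `C` of sets of one side
of a rectangle `C × D` contains more than an exponentially small part of the subsets of `T ∪ {i}`,
then for most points `i` about half of these contain `i`: a family with many rare points is small
by a Chernoff bound (`card_le_of_rare`). So a rectangle contains at least `9/50` as much of the
intersecting pairs as of the disjoint pairs, up to an error `exp (-Ω(m))`
(`disjointness_corruption`). A deterministic protocol accepts on a union of at most `2 ^ (2 p s)`
disjoint rectangles, so its accepting set obeys the same bound with the error multiplied by that
number (`neg_le_sum_accepted`). Averaging over the coin flips, a protocol with error `1/10` would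
violate the bound, as `9/50 * 9/10 > 1/10`, unless `2 ^ (2 p s)` is exponential in `m`
(`disjointness_lower_bound`).
-/

/-! ### A Chernoff bound for set families -/

section Corruption

open Finset

variable {ι : Type*} [DecidableEq ι]

theorem one_add_exp_neg_half_le :
    1 + Real.exp (-(1 / 2 : ℝ)) ≤ 2 * Real.exp (-(7 / 32 : ℝ)) := by
  have h := Real.cosh_le_exp_half_sq (1 / 4)
  have h1 : 1 + Real.exp (-(1 / 2 : ℝ)) = 2 * (Real.exp (-(1 / 4 : ℝ)) * Real.cosh (1 / 4)) := by
    rw [Real.cosh_eq, mul_div_assoc', mul_add, ← Real.exp_add, ← Real.exp_add]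
    norm_num
    ring
  have h2 : Real.exp (-(7 / 32 : ℝ)) = Real.exp (-(1 / 4 : ℝ)) * Real.exp ((1 / 4) ^ 2 / 2) := by
    rw [← Real.exp_add]; norm_num
  rw [h1, h2]
  gcongr

/-- The moment generating function of `|x ∩ I|` for a uniformly random subset `x` of `Z`. -/
theorem sum_powerset_exp_le (Z I : Finset ι) (hI : I ⊆ Z) :
    ∑ x ∈ Z.powerset, Real.exp (-((#(x ∩ I) : ℝ) / 2)) ≤
      2 ^ #Z * Real.exp (-(7 / 32 * (#I : ℝ))) := by
  have h1 : ∀ x ∈ Z.powerset, Real.exp (-((#(x ∩ I) : ℝ) / 2)) =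
      ∏ i ∈ x, (if i ∈ I then Real.exp (-(1 / 2 : ℝ)) else 1) := by
    intro x _
    rw [← prod_filter, prod_const, ← Real.exp_nat_mul, filter_mem_eq_inter]
    congr 1; ring
  rw [sum_congr rfl h1, ← prod_one_add]
  have h2 : ∏ i ∈ Z, (1 + if i ∈ I then Real.exp (-(1 / 2 : ℝ)) else 1) ≤
      ∏ i ∈ Z, (2 * if i ∈ I then Real.exp (-(7 / 32 : ℝ)) else 1) := by
    refine prod_le_prod (fun i _ => by positivity) (fun i _ => ?_)
    split_ifs
    · exact one_add_exp_neg_half_le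
    · norm_num
  refine h2.trans (le_of_eq ?_)
  rw [prod_mul_distrib, prod_const, ← prod_filter, prod_const, ← Real.exp_nat_mul,
    filter_mem_eq_inter, inter_eq_right.2 hI]
  congr 2; ring

/-- A family of subsets of `Z` in which every point of `I` is rare (it lies in at most `3/8` of the
members) is exponentially small in `|I|`. -/
theorem card_le_of_rare {Z I : Finset ι} (hI : I ⊆ Z) {F : Finset (Finset ι)}
    (hF : F ⊆ Z.powerset) (h : ∀ i ∈ I, (#{x ∈ F | i ∈ x} : ℝ) ≤ 3 / 8 * #F) :
    (#F : ℝ) ≤ 2 ^ #Z * Real.exp (-((#I : ℝ) / 32)) := by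
  have hsum : ∑ x ∈ F, (#(x ∩ I) : ℝ) ≤ #I * (3 / 8 * #F) := by
    have : ∑ x ∈ F, (#(x ∩ I) : ℝ) = ∑ i ∈ I, (#{x ∈ F | i ∈ x} : ℝ) := by
      have h1 : ∀ x ∈ F, (#(x ∩ I) : ℝ) = ∑ i ∈ I, if i ∈ x then (1 : ℝ) else 0 := by
        intro x _
        rw [sum_boole, filter_mem_eq_inter, inter_comm]
      rw [sum_congr rfl h1, sum_comm]
      exact sum_congr rfl fun i _ => by rw [sum_boole]
    rw [this]
    exact (sum_le_sum h).trans (by simp)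
  -- The tangent to `exp` at the mean bound `-(3/16) |I|` takes the place of Jensen's inequality.
  have htan : ∀ x ∈ F, Real.exp (-(3 / 16 * (#I : ℝ))) *
      (1 + (3 / 16 * (#I : ℝ) - (#(x ∩ I) : ℝ) / 2)) ≤ Real.exp (-((#(x ∩ I) : ℝ) / 2)) := by
    intro x _
    have h1 := Real.add_one_le_exp (3 / 16 * (#I : ℝ) - (#(x ∩ I) : ℝ) / 2)
    calc _ ≤ Real.exp (-(3 / 16 * (#I : ℝ))) *
          Real.exp (3 / 16 * (#I : ℝ) - (#(x ∩ I) : ℝ) / 2) := by gcongr; linarith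
      _ = _ := by rw [← Real.exp_add]; congr 1; ring
  have hlow : Real.exp (-(3 / 16 * (#I : ℝ))) * #F ≤
      ∑ x ∈ F, Real.exp (-((#(x ∩ I) : ℝ) / 2)) := by
    refine le_trans ?_ (sum_le_sum htan)
    rw [← mul_sum]
    gcongr
    rw [sum_add_distrib, sum_sub_distrib, ← sum_div]
    simp only [sum_const, nsmul_eq_mul, mul_one]
    linarith
  have hup := (hlow.trans (sum_le_sum_of_subset_of_nonneg hF
    fun _ _ _ => (Real.exp_pos _).le)).trans (sum_powerset_exp_le Z I hI)
  have h3 : Real.exp (-(7 / 32 * (#I : ℝ))) =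
      Real.exp (-(3 / 16 * (#I : ℝ))) * Real.exp (-((#I : ℝ) / 32)) := by
    rw [← Real.exp_add]; congr 1; ring
  rw [h3, mul_left_comm] at hup
  exact le_of_mul_le_mul_left hup (Real.exp_pos _)

/-! ### Rare and frequent points of a set family -/

/-- The number of members of `C` that are subsets of `T`. -/
def subsetCount (C : Finset (Finset ι)) (T : Finset ι) : ℝ := #{x ∈ C | x ⊆ T}

/-- The number of members of `C` that contain `i` and are subsets of `T ∪ {i}`. -/
def pointedCount (C : Finset (Finset ι)) (i : ι) (T : Finset ι) : ℝ :=
  #{x ∈ C | i ∈ x ∧ x ⊆ insert i T}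

theorem subsetCount_nonneg (C : Finset (Finset ι)) (T : Finset ι) : 0 ≤ subsetCount C T :=
  Nat.cast_nonneg _

theorem pointedCount_nonneg (C : Finset (Finset ι)) (i : ι) (T : Finset ι) :
    0 ≤ pointedCount C i T :=
  Nat.cast_nonneg _

theorem subsetCount_le (C : Finset (Finset ι)) (T : Finset ι) : subsetCount C T ≤ 2 ^ #T := by
  unfold subsetCount
  rw [← Nat.cast_two, ← Nat.cast_pow, ← card_powerset]
  exact_mod_cast card_le_card fun x hx => mem_powerset.2 (mem_filter.1 hx).2

theorem subsetCount_add_pointedCount (C : Finset (Finset ι)) {i : ι} {Z : Finset ι} (hi : i ∈ Z) :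
    subsetCount C (Z.erase i) + pointedCount C i (Z.erase i) = subsetCount C Z := by
  unfold subsetCount pointedCount
  rw [← Nat.cast_add, insert_erase hi, ← card_union_of_disjoint]
  · congr 2
    ext x
    simp only [mem_union, mem_filter, subset_erase]
    tauto
  · rw [disjoint_left]
    intro x hx hx'
    exact (subset_erase.1 (mem_filter.1 hx).2).2 (mem_filter.1 hx').2.1

/-- If the subsets of `Z` in `C` are not exponentially few, then few points of `Z` lie in less than
`3/8` of them. -/
theorem card_rare_lt {C : Finset (Finset ι)} {Z : Finset ι} {K : ℝ}
    (hC : 2 ^ #Z * Real.exp (-(K / 32)) < subsetCount C Z) :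
    (#{i ∈ Z | pointedCount C i (Z.erase i) < 3 / 8 * subsetCount C Z} : ℝ) < K := by
  set I := {i ∈ Z | pointedCount C i (Z.erase i) < 3 / 8 * subsetCount C Z} with hI
  have h := card_le_of_rare (Z := Z) (I := I) (filter_subset _ _) (F := {x ∈ C | x ⊆ Z})
    (fun x hx => mem_powerset.2 (mem_filter.1 hx).2) (fun i hi => by
      obtain ⟨hiZ, hi⟩ := mem_filter.1 hi
      unfold pointedCount at hi
      rw [insert_erase hiZ] at hi
      rw [filter_filter]
      simp_rw [and_comm] at hi ⊢
      exact hi.le)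
  have h2 := lt_of_mul_lt_mul_left (hC.trans_le h) (by positivity)
  have := Real.exp_lt_exp.1 h2
  linarith

/-- If the subsets of `Z` in `C` are not exponentially few, then few points of `Z` are avoided by
less than `3/8` of them. -/
theorem card_frequent_lt {C : Finset (Finset ι)} {Z : Finset ι} {K : ℝ}
    (hC : 2 ^ #Z * Real.exp (-(K / 32)) < subsetCount C Z) :
    (#{i ∈ Z | subsetCount C (Z.erase i) < 3 / 8 * subsetCount C Z} : ℝ) < K := by
  -- Complementation within `Z` exchanges the points avoided with the points contained.
  have hinj : Set.InjOn (fun x => Z \ x) ({x ∈ C | x ⊆ Z} : Finset (Finset ι)) := by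
    intro x hx y hy hxy
    simp only [coe_filter, Set.mem_ofPred_eq] at hx hy
    rw [← Finset.sdiff_sdiff_eq_self hx.2, ← Finset.sdiff_sdiff_eq_self hy.2]
    exact congrArg (Z \ ·) hxy
  set I := {i ∈ Z | subsetCount C (Z.erase i) < 3 / 8 * subsetCount C Z} with hI
  have hcard := card_image_of_injOn hinj
  have h := card_le_of_rare (Z := Z) (I := I) (filter_subset _ _)
    (F := ({x ∈ C | x ⊆ Z} : Finset (Finset ι)).image fun x => Z \ x)
    (fun x hx => by
      obtain ⟨y, -, rfl⟩ := mem_image.1 hx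
      exact mem_powerset.2 sdiff_subset)
    (fun i hi => by
      obtain ⟨hiZ, hi⟩ := mem_filter.1 hi
      rw [hcard]
      refine le_trans ?_ hi.le
      unfold subsetCount
      rw [filter_image]
      exact_mod_cast card_image_le.trans (card_le_card fun x hx => by
        simp only [mem_filter, mem_sdiff, subset_erase] at hx ⊢
        tauto))
  rw [hcard] at h
  have h2 := lt_of_mul_lt_mul_left (hC.trans_le h) (by positivity)
  have := Real.exp_lt_exp.1 h2
  linarith

/-- For a random `i ∈ Z`, the sets of `C` inside `Z` that avoid `i` seldom occur together with an `i`
that is rare in `C`. If the subsets of `Z` in `C` are not exponentially few, fewer than `|Z| / 16`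
points are rare, and fewer than `|Z| / 16` are avoided by less than `3/8` of these subsets;
otherwise the last term covers everything. -/
theorem sum_rare_subsetCount_le (C : Finset (Finset ι)) {Z : Finset ι} :
    ∑ i ∈ Z with pointedCount C i (Z.erase i) < 3 / 8 * subsetCount C Z,
        subsetCount C (Z.erase i) ≤
      1 / 4 * ∑ i ∈ Z, subsetCount C (Z.erase i) +
        #Z * (2 ^ #Z * Real.exp (-((#Z : ℝ) / 512))) := by
  set B := {i ∈ Z | pointedCount C i (Z.erase i) < 3 / 8 * subsetCount C Z} with hB
  have hle : ∀ i ∈ Z, subsetCount C (Z.erase i) ≤ subsetCount C Z := fun i hi => by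
    have := subsetCount_add_pointedCount C hi
    have := pointedCount_nonneg C i (Z.erase i)
    linarith
  have hsum : ∑ i ∈ B, subsetCount C (Z.erase i) ≤ #B * subsetCount C Z := by
    refine (sum_le_sum fun i hi => hle i (mem_filter.1 hi).1).trans (by simp [hB])
  have h0 := subsetCount_nonneg C Z
  have hBZ : (#B : ℝ) ≤ #Z := by exact_mod_cast card_filter_le _ _
  have htot : 0 ≤ ∑ i ∈ Z, subsetCount C (Z.erase i) :=
    sum_nonneg fun i _ => subsetCount_nonneg _ _
  rcases le_or_gt (subsetCount C Z) (2 ^ #Z * Real.exp (-((#Z : ℝ) / 512))) with hC | hC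
  · have : (#B : ℝ) * subsetCount C Z ≤ #Z * (2 ^ #Z * Real.exp (-((#Z : ℝ) / 512))) := by gcongr
    linarith
  · have hC' : 2 ^ #Z * Real.exp (-((#Z / 16 : ℝ) / 32)) < subsetCount C Z := by
      have e : -((#Z / 16 : ℝ) / 32) = -((#Z : ℝ) / 512) := by ring
      rwa [e]
    have h1 := card_rare_lt hC'
    have h2 := card_frequent_lt hC'
    rw [← hB] at h1
    have hsplit := card_filter_add_card_filter_not (s := Z)
      (fun i => subsetCount C (Z.erase i) < 3 / 8 * subsetCount C Z)
    have hsplit' : (#{i ∈ Z | subsetCount C (Z.erase i) < 3 / 8 * subsetCount C Z} : ℝ) +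
      #{i ∈ Z | ¬ subsetCount C (Z.erase i) < 3 / 8 * subsetCount C Z} = #Z := by
      exact_mod_cast hsplit
    have hlow : (#{i ∈ Z | ¬ subsetCount C (Z.erase i) < 3 / 8 * subsetCount C Z} : ℝ) *
        (3 / 8 * subsetCount C Z) ≤ ∑ i ∈ Z, subsetCount C (Z.erase i) := by
      refine le_trans ?_ (sum_le_sum_of_subset_of_nonneg (filter_subset
        (fun i => ¬ subsetCount C (Z.erase i) < 3 / 8 * subsetCount C Z) Z)
        fun i _ _ => subsetCount_nonneg _ _)
      rw [← nsmul_eq_mul]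
      exact card_nsmul_le_sum _ _ _ fun i hi => not_lt.1 (mem_filter.1 hi).2
    have h3 : (15 / 16 * #Z : ℝ) * (3 / 8 * subsetCount C Z) ≤
        ∑ i ∈ Z, subsetCount C (Z.erase i) := by
      refine le_trans ?_ hlow
      gcongr
      linarith
    have h4 : (#B : ℝ) * subsetCount C Z ≤ (#Z / 16) * subsetCount C Z := by gcongr
    have h5 : 0 ≤ (#Z : ℝ) * subsetCount C Z := by positivity
    have h6 : 0 ≤ (#Z : ℝ) * (2 ^ #Z * Real.exp (-((#Z : ℝ) / 512))) := by positivity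
    linarith

/-- The split `(i, T)` is skewed for `C` if less than `3/8` of the members of `C` inside `T ∪ {i}`
contain `i`. -/
def IsSkewed (C : Finset (Finset ι)) (t : ι × Finset ι) : Prop :=
  pointedCount C t.1 t.2 < 3 / 8 * subsetCount C (insert t.1 t.2)

/-- Outside the skewed splits, the members of `C` that contain `i` are not much fewer than those
that avoid it. -/
theorem subsetCount_le_of_not_isSkewed {C : Finset (Finset ι)} {t : ι × Finset ι}
    (ht : t.1 ∉ t.2) (h : ¬ IsSkewed C t) :
    3 / 5 * subsetCount C t.2 ≤ pointedCount C t.1 t.2 := by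
  have h1 := subsetCount_add_pointedCount C (mem_insert_self t.1 t.2)
  rw [erase_insert ht] at h1
  unfold IsSkewed at h
  linarith

/-! ### The corruption bound for set disjointness -/

variable [Fintype ι]

/-- The pairs `(i, T)` of a point `i` and an `m`-set `T` that avoids it. For a ground set of
`2 m + 1` points they stand for the ways to split the points into `{i}` and two `m`-sets, `T` and
the complement of `T ∪ {i}`. -/
def splits (ι : Type*) [DecidableEq ι] [Fintype ι] (m : ℕ) : Finset (ι × Finset ι) :=
  {t | t.1 ∉ t.2 ∧ #t.2 = m}

theorem mem_splits {m : ℕ} {t : ι × Finset ι} : t ∈ splits ι m ↔ t.1 ∉ t.2 ∧ #t.2 = m := by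
  simp [splits]

/-- The second `m`-set of a split. -/
def otherSide (t : ι × Finset ι) : Finset ι := (insert t.1 t.2)ᶜ

theorem otherSide_mem_splits {m : ℕ} (hι : Fintype.card ι = 2 * m + 1) {t : ι × Finset ι}
    (ht : t ∈ splits ι m) : (t.1, otherSide t) ∈ splits ι m := by
  rw [mem_splits] at ht ⊢
  refine ⟨by simp [otherSide], ?_⟩
  rw [otherSide, card_compl, card_insert_of_notMem ht.1, hι, ht.2]
  omega

theorem otherSide_otherSide {t : ι × Finset ι} (ht : t.1 ∉ t.2) :
    otherSide (t.1, otherSide t) = t.2 := by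
  ext j
  simp only [otherSide, mem_compl, mem_insert, not_or, not_and, not_not]
  constructor
  · rintro ⟨h1, h2⟩
    exact h2 h1
  · intro h
    exact ⟨fun hj => ht (hj ▸ h), fun _ => h⟩

theorem sum_splits_otherSide {m : ℕ} (hι : Fintype.card ι = 2 * m + 1)
    (f : ι × Finset ι → ℝ) :
    ∑ t ∈ splits ι m, f (t.1, otherSide t) = ∑ t ∈ splits ι m, f t := by
  refine sum_bij' (fun t _ => (t.1, otherSide t)) (fun t _ => (t.1, otherSide t))
    (fun t ht => otherSide_mem_splits hι ht) (fun t ht => otherSide_mem_splits hι ht) ?_ ?_ ?_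
  · intro t ht
    exact Prod.ext rfl (otherSide_otherSide (mem_splits.1 ht).1)
  · intro t ht
    exact Prod.ext rfl (otherSide_otherSide (mem_splits.1 ht).1)
  · intro t ht
    rfl

/-- A split can be drawn by choosing the `(m + 1)`-set `Z = T ∪ {i}` first and `i ∈ Z` second. -/
theorem sum_splits_eq {m : ℕ} (f : ι × Finset ι → ℝ) :
    ∑ t ∈ splits ι m, f t =
      ∑ Z ∈ powersetCard (m + 1) (univ : Finset ι), ∑ i ∈ Z, f (i, Z.erase i) := by
  rw [sum_sigma']
  refine sum_bij' (fun t _ => ⟨insert t.1 t.2, t.1⟩) (fun z _ => (z.2, z.1.erase z.2)) ?_ ?_ ?_ ?_ ?_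
  · intro t ht
    rw [mem_splits] at ht
    simp [mem_powersetCard, card_insert_of_notMem ht.1, ht.2]
  · intro z hz
    simp only [mem_sigma, mem_powersetCard] at hz
    rw [mem_splits]
    refine ⟨notMem_erase _ _, ?_⟩
    rw [card_erase_of_mem hz.2, hz.1.2]
    rfl
  · intro t ht
    rw [mem_splits] at ht
    simp [erase_insert ht.1]
  · intro z hz
    simp only [mem_sigma] at hz
    simp [insert_erase hz.2]
  · intro t ht
    rw [mem_splits] at ht
    simp [erase_insert ht.1]

open Classical in
/-- Skewed splits carry little of the mass of the disjoint pairs in `C × D`: once `T ∪ {i}` is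
fixed, the factor of `D` does not depend on `i`, and the factor of `C` is about the same for most
choices of `i`. -/
theorem sum_isSkewed_le {m : ℕ} (hι : Fintype.card ι = 2 * m + 1) (C D : Finset (Finset ι)) :
    ∑ t ∈ splits ι m, (if IsSkewed C t then
        subsetCount C t.2 * subsetCount D (otherSide t) else 0) ≤
      1 / 4 * ∑ t ∈ splits ι m, subsetCount C t.2 * subsetCount D (otherSide t) +
        #(splits ι m) * (2 * 4 ^ m * Real.exp (-((m + 1 : ℝ) / 512))) := by
  have hcard : (#(splits ι m) : ℝ) = ∑ t ∈ splits ι m, (1 : ℝ) := by simp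
  rw [hcard, sum_splits_eq, sum_splits_eq, sum_splits_eq, mul_sum, sum_mul, ← sum_add_distrib]
  refine sum_le_sum fun Z hZ => ?_
  have hZc : #Z = m + 1 := (mem_powersetCard.1 hZ).2
  have hother : ∀ i ∈ Z, otherSide (i, Z.erase i) = Zᶜ := fun i hi => by
    simp [otherSide, insert_erase hi]
  have hD : subsetCount D Zᶜ ≤ 2 ^ m := by
    refine (subsetCount_le D Zᶜ).trans (le_of_eq ?_)
    rw [card_compl, hZc, hι]
    congr 1; omega
  have hD0 := subsetCount_nonneg D Zᶜ
  have key := sum_rare_subsetCount_le C (Z := Z)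
  have e1 : ∑ i ∈ Z, (if IsSkewed C (i, Z.erase i) then
      subsetCount C (Z.erase i) * subsetCount D (otherSide (i, Z.erase i)) else 0) =
      (∑ i ∈ Z with pointedCount C i (Z.erase i) < 3 / 8 * subsetCount C Z,
        subsetCount C (Z.erase i)) * subsetCount D Zᶜ := by
    rw [sum_filter, sum_mul]
    refine sum_congr rfl fun i hi => ?_
    simp only [IsSkewed, insert_erase hi, hother i hi, ite_mul, zero_mul]
  have e2 : ∑ i ∈ Z, subsetCount C (Z.erase i) * subsetCount D (otherSide (i, Z.erase i)) =
      (∑ i ∈ Z, subsetCount C (Z.erase i)) * subsetCount D Zᶜ := by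
    rw [sum_mul]
    exact sum_congr rfl fun i hi => by rw [hother i hi]
  simp only [e1, e2]
  refine (mul_le_mul_of_nonneg_right key hD0).trans ?_
  rw [add_mul, mul_assoc]
  refine add_le_add_right ?_ _
  have h4 : (4 : ℝ) ^ m = 2 ^ m * 2 ^ m := by rw [← mul_pow]; norm_num
  have hpos : 0 ≤ (#Z : ℝ) * (2 ^ #Z * Real.exp (-((#Z : ℝ) / 512))) := by positivity
  refine (mul_le_mul_of_nonneg_left hD hpos).trans (le_of_eq ?_)
  rw [sum_const, nsmul_eq_mul, mul_one, h4, hZc]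
  push_cast
  ring

/-- **Corruption bound for set disjointness.** A combinatorial rectangle `C × D` holds at least a
constant fraction as much of the uniquely intersecting pairs as of the disjoint pairs, up to an
exponentially small error. -/
theorem disjointness_corruption {m : ℕ} (hι : Fintype.card ι = 2 * m + 1)
    (C D : Finset (Finset ι)) :
    9 / 50 * ∑ t ∈ splits ι m, subsetCount C t.2 * subsetCount D (otherSide t) -
        #(splits ι m) * (4 ^ m * (36 / 25 * Real.exp (-((m + 1 : ℝ) / 512)))) ≤
      ∑ t ∈ splits ι m, pointedCount C t.1 t.2 * pointedCount D t.1 (otherSide t) := by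
  classical
  have hC := sum_isSkewed_le hι C D
  have hD := sum_isSkewed_le hι D C
  rw [← sum_splits_otherSide hι, ← sum_splits_otherSide hι
    (fun t => subsetCount D t.2 * subsetCount C (otherSide t))] at hD
  have hpt : ∀ t ∈ splits ι m,
      9 / 25 * (subsetCount C t.2 * subsetCount D (otherSide t) -
        (if IsSkewed C t then subsetCount C t.2 * subsetCount D (otherSide t) else 0) -
        (if IsSkewed D (t.1, otherSide t) then
          subsetCount D (otherSide t) * subsetCount C (otherSide (t.1, otherSide t)) else 0)) ≤
      pointedCount C t.1 t.2 * pointedCount D t.1 (otherSide t) := by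
    intro t ht
    have ht1 := (mem_splits.1 ht).1
    rw [otherSide_otherSide ht1]
    have hp : 0 ≤ subsetCount C t.2 * subsetCount D (otherSide t) :=
      mul_nonneg (subsetCount_nonneg _ _) (subsetCount_nonneg _ _)
    have hq : 0 ≤ pointedCount C t.1 t.2 * pointedCount D t.1 (otherSide t) :=
      mul_nonneg (pointedCount_nonneg _ _ _) (pointedCount_nonneg _ _ _)
    by_cases h1 : IsSkewed C t
    · rw [if_pos h1]
      split_ifs <;> linarith
    · by_cases h2 : IsSkewed D (t.1, otherSide t)
      · rw [if_pos h2, if_neg h1]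
        linarith
      · rw [if_neg h1, if_neg h2]
        have a1 := subsetCount_le_of_not_isSkewed ht1 h1
        have a2 := subsetCount_le_of_not_isSkewed (t := (t.1, otherSide t))
          (by simp [otherSide]) h2
        have := mul_le_mul a1 a2 (mul_nonneg (by norm_num) (subsetCount_nonneg _ _))
          (pointedCount_nonneg _ _ _)
        simp only at this
        linarith
  have hs := sum_le_sum hpt
  rw [← mul_sum, sum_sub_distrib, sum_sub_distrib] at hs
  have hsym : ∑ t ∈ splits ι m,
      subsetCount D (otherSide t) * subsetCount C (otherSide (t.1, otherSide t)) =
      ∑ t ∈ splits ι m, subsetCount C t.2 * subsetCount D (otherSide t) :=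
    sum_congr rfl fun t ht => by rw [otherSide_otherSide (mem_splits.1 ht).1, mul_comm]
  simp only [hsym] at hD
  linarith

end Corruption

/-! ### Protocols and rectangles -/

section TwoParty

open Finset

/-- If a weight `φ` has mass at least `-δ` on every combinatorial rectangle, then it has mass at
least `-δ |M|^(2 k)` on the set of pairs that a protocol of `k` rounds accepts; in a round the first
party updates the message `m : M` according to `x`, and then the second does according to `y`.
Each message splits a rectangle into `|M|` smaller ones. -/
theorem neg_le_sum_accepted {X Y M I : Type*} [Fintype M] (φ : X → Y → ℝ) (δ : ℝ)
    (hφ : ∀ (C : Finset X) (D : Finset Y), -δ ≤ ∑ x ∈ C, ∑ y ∈ D, φ x y)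
    (f : I → M → X → M) (g : I → M → Y → M) (out : M → Bool) (L : List I) :
    ∀ (m : M) (C : Finset X) (D : Finset Y),
      -(δ * (Fintype.card M : ℝ) ^ (2 * L.length)) ≤ ∑ x ∈ C, ∑ y ∈ D,
        if out (L.foldl (fun m' i => g i (f i m' x) y) m) = true then φ x y else 0 := by
  classical
  induction L with
  | nil =>
    intro m C D
    by_cases h : out m = true
    · simpa [h] using hφ C D
    · have hδ : 0 ≤ δ := by simpa using hφ ∅ ∅
      simpa [h] using hδ
  | cons i L ih =>
    intro m C D
    have hsplit : (∑ x ∈ C, ∑ y ∈ D,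
        if out ((i :: L).foldl (fun m' i => g i (f i m' x) y) m) = true then φ x y else 0) =
        ∑ a : M, ∑ b : M, ∑ x ∈ C with f i m x = a, ∑ y ∈ D with g i a y = b,
          if out (L.foldl (fun m' i => g i (f i m' x) y) b) = true then φ x y else 0 := by
      rw [← sum_fiberwise C (f i m)]
      refine sum_congr rfl fun a _ => ?_
      refine Eq.trans (sum_congr rfl fun x hx => ?_) sum_comm
      rw [← sum_fiberwise D (g i a)]
      refine sum_congr rfl fun b _ => sum_congr rfl fun y hy => ?_
      rw [List.foldl_cons, (mem_filter.1 hx).2, (mem_filter.1 hy).2]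
    rw [hsplit]
    have hle : ∑ a : M, ∑ b : M, -(δ * (Fintype.card M : ℝ) ^ (2 * L.length)) ≤
        ∑ a : M, ∑ b : M, ∑ x ∈ C with f i m x = a, ∑ y ∈ D with g i a y = b,
          if out (L.foldl (fun m' i => g i (f i m' x) y) b) = true then φ x y else 0 :=
      sum_le_sum fun a _ => sum_le_sum fun b _ => ih b _ _
    refine le_trans (le_of_eq ?_) hle
    simp only [sum_const, card_univ, nsmul_eq_mul, List.length_cons]
    ring

end TwoParty

/-! ### The communication complexity of disjointness -/

section Disjointness

open Finset

variable {ι : Type*} [DecidableEq ι] [Fintype ι]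

/-- Summing over the splits `(i, T)`, the number of times `(x, y)` is drawn as a pair of sets that
meet exactly in `i`, less `9/50` of the number of times it is drawn as a disjoint pair. -/
noncomputable def disjWeight (m : ℕ) (x y : Finset ι) : ℝ :=
  ∑ t ∈ splits ι m,
    ((if t.1 ∈ x ∧ x ⊆ insert t.1 t.2 then 1 else 0) *
      (if t.1 ∈ y ∧ y ⊆ insert t.1 (otherSide t) then 1 else 0) -
    9 / 50 * ((if x ⊆ t.2 then 1 else 0) * (if y ⊆ otherSide t then 1 else 0)))

theorem sum_sum_splits (m : ℕ) (C D : Finset (Finset ι)) (a b : ℝ) :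
    ∑ x ∈ C, ∑ y ∈ D, ∑ t ∈ splits ι m,
      (a * ((if t.1 ∈ x ∧ x ⊆ insert t.1 t.2 then 1 else 0) *
        (if t.1 ∈ y ∧ y ⊆ insert t.1 (otherSide t) then 1 else 0)) -
      b * ((if x ⊆ t.2 then 1 else 0) * (if y ⊆ otherSide t then 1 else 0))) =
    a * ∑ t ∈ splits ι m, pointedCount C t.1 t.2 * pointedCount D t.1 (otherSide t) -
      b * ∑ t ∈ splits ι m, subsetCount C t.2 * subsetCount D (otherSide t) := by
  rw [mul_sum, mul_sum, ← sum_sub_distrib]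
  have hcomm : ∀ F : Finset ι → Finset ι → ι × Finset ι → ℝ,
      ∑ x ∈ C, ∑ y ∈ D, ∑ t ∈ splits ι m, F x y t =
        ∑ t ∈ splits ι m, ∑ x ∈ C, ∑ y ∈ D, F x y t := by
    intro F
    exact (sum_congr rfl fun x _ => sum_comm).trans sum_comm
  rw [hcomm]
  refine sum_congr rfl fun t _ => ?_
  simp only [sum_sub_distrib, ← mul_sum, ← sum_mul, sum_boole]
  rfl

theorem neg_le_sum_disjWeight {m : ℕ} (hι : Fintype.card ι = 2 * m + 1)
    (C D : Finset (Finset ι)) :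
    -(#(splits ι m) * (4 ^ m * (36 / 25 * Real.exp (-((m + 1 : ℝ) / 512))))) ≤
      ∑ x ∈ C, ∑ y ∈ D, disjWeight m x y := by
  have h1 := disjointness_corruption hι C D
  have h2 := sum_sum_splits m C D 1 (9 / 50)
  simp only [one_mul] at h2
  unfold disjWeight
  rw [h2]
  linarith

theorem subsetCount_univ (T : Finset ι) : subsetCount univ T = 2 ^ #T := by
  unfold subsetCount
  rw [← Nat.cast_two, ← Nat.cast_pow, ← card_powerset]
  congr 2
  ext x
  simp

theorem pointedCount_univ {i : ι} {T : Finset ι} (hi : i ∉ T) :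
    pointedCount univ i T = 2 ^ #T := by
  have h := subsetCount_add_pointedCount univ (mem_insert_self i T)
  rw [erase_insert hi, subsetCount_univ, subsetCount_univ, card_insert_of_notMem hi, pow_succ] at h
  linarith

/-- If disjoint pairs are accepted with probability at least `9/10` and intersecting ones with
probability at most `1/10`, then the expected weight of the accepted pairs is negative. -/
theorem sum_mul_disjWeight_le {m : ℕ} (hι : Fintype.card ι = 2 * m + 1)
    (P : Finset ι → Finset ι → ℝ) (hdisj : ∀ x y, Disjoint x y → 9 / 10 ≤ P x y)
    (hmeet : ∀ x y, ¬ Disjoint x y → P x y ≤ 1 / 10) :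
    ∑ x : Finset ι, ∑ y : Finset ι, P x y * disjWeight m x y ≤
      -(#(splits ι m) * (4 ^ m * (31 / 500))) := by
  have hpt : ∀ x y : Finset ι, P x y * disjWeight m x y ≤ ∑ t ∈ splits ι m,
      (1 / 10 * ((if t.1 ∈ x ∧ x ⊆ insert t.1 t.2 then 1 else 0) *
        (if t.1 ∈ y ∧ y ⊆ insert t.1 (otherSide t) then 1 else 0)) -
      81 / 500 * ((if x ⊆ t.2 then 1 else 0) * (if y ⊆ otherSide t then 1 else 0))) := by
    intro x y
    unfold disjWeight
    rw [mul_sum]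
    refine sum_le_sum fun t _ => ?_
    rw [mul_sub]
    refine sub_le_sub ?_ ?_
    · split_ifs with h1 h2 <;> try simp
      have := hmeet x y (not_disjoint_iff.2 ⟨t.1, h1.1, h2.1⟩)
      linarith
    · split_ifs with h1 h2 <;> try simp
      have := hdisj x y ((disjoint_left.2 fun i hi hi' => by
        have := h2 hi'
        rw [otherSide, mem_compl, mem_insert, not_or] at this
        exact this.2 (h1 hi)))
      linarith
  refine (sum_le_sum fun x _ => sum_le_sum fun y _ => hpt x y).trans ?_
  rw [sum_sum_splits]
  have h4 : (2 : ℝ) ^ m * 2 ^ m = 4 ^ m := by rw [← mul_pow]; norm_num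
  have e1 : ∑ t ∈ splits ι m, pointedCount univ t.1 t.2 * pointedCount univ t.1 (otherSide t) =
      #(splits ι m) * 4 ^ m := by
    rw [← nsmul_eq_mul, ← sum_const]
    refine sum_congr rfl fun t ht => ?_
    have h1 := mem_splits.1 ht
    have h2 := mem_splits.1 (otherSide_mem_splits hι ht)
    rw [pointedCount_univ h1.1, pointedCount_univ h2.1, h1.2, h2.2, h4]
  have e2 : ∑ t ∈ splits ι m, subsetCount univ t.2 * subsetCount univ (otherSide t) =
      #(splits ι m) * 4 ^ m := by
    rw [← nsmul_eq_mul, ← sum_const]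
    refine sum_congr rfl fun t ht => ?_
    have h1 := mem_splits.1 ht
    have h2 := mem_splits.1 (otherSide_mem_splits hι ht)
    rw [subsetCount_univ, subsetCount_univ, h1.2, h2.2, h4]
  rw [e1, e2]
  linarith

theorem splits_card_pos {m : ℕ} (hι : Fintype.card ι = 2 * m + 1) : 0 < #(splits ι m) := by
  have hpos : 0 < Fintype.card ι := by omega
  obtain ⟨i⟩ := Fintype.card_pos_iff.1 hpos
  obtain ⟨T, hT, hTc⟩ := exists_subset_card_eq (s := univ.erase i) (n := m)
    (by rw [card_erase_of_mem (mem_univ i), card_univ]; omega)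
  exact card_pos.2 ⟨(i, T), mem_splits.2 ⟨fun h => notMem_erase i univ (hT h), hTc⟩⟩

/-- The communication lower bound for set disjointness: if a randomized protocol of `p` rounds with
messages from `M` accepts the disjoint pairs and rejects the others, each with probability at least
`9/10`, then the number `|M|^(2 p)` of transcripts is exponential in `m`. -/
theorem disjointness_lower_bound {m p : ℕ} (hι : Fintype.card ι = 2 * m + 1)
    {M Ω : Type*} [Fintype M] [MeasurableSpace Ω] (μ : MeasureTheory.Measure Ω)
    [MeasureTheory.IsProbabilityMeasure μ]
    (f : Ω → Fin p → M → Finset ι → M) (g : Ω → Fin p → M → Finset ι → M) (init : Ω → M)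
    (out : Ω → M → Bool) (acc : Ω → Finset ι → Finset ι → Bool)
    (hacc : ∀ ω x y, acc ω x y =
      out ω ((List.finRange p).foldl (fun m' i => g ω i (f ω i m' x) y) (init ω)))
    (hmeas : ∀ x y, MeasurableSet {ω | acc ω x y = true})
    (hdisj : ∀ x y, Disjoint x y → 9 / 10 ≤ μ.real {ω | acc ω x y = true})
    (hmeet : ∀ x y, ¬ Disjoint x y → μ.real {ω | acc ω x y = true} ≤ 1 / 10) :
    31 / 720 ≤ Real.exp (-((m + 1 : ℝ) / 512)) * (Fintype.card M : ℝ) ^ (2 * p) := by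
  classical
  set δ : ℝ := #(splits ι m) * (4 ^ m * (36 / 25 * Real.exp (-((m + 1 : ℝ) / 512)))) with hδ
  have hω : ∀ ω, -(δ * (Fintype.card M : ℝ) ^ (2 * p)) ≤ ∑ x : Finset ι, ∑ y : Finset ι,
      {ω | acc ω x y = true}.indicator (fun _ => disjWeight m x y) ω := by
    intro ω
    have h := neg_le_sum_accepted (disjWeight (ι := ι) m) δ (neg_le_sum_disjWeight hι)
      (f ω) (g ω) (out ω) (List.finRange p) (init ω) univ univ
    rw [List.length_finRange] at h
    simpa only [← hacc, Set.indicator_apply, Set.mem_ofPred_eq] using h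
  have hint : ∀ x y : Finset ι, MeasureTheory.Integrable
      ({ω | acc ω x y = true}.indicator (fun _ => disjWeight m x y)) μ := fun x y =>
    (MeasureTheory.integrable_const _).indicator (hmeas x y)
  have hE := MeasureTheory.integral_mono (μ := μ) (MeasureTheory.integrable_const _)
    (MeasureTheory.integrable_finsetSum _ fun x _ =>
      MeasureTheory.integrable_finsetSum _ fun y _ => hint x y) hω
  rw [MeasureTheory.integral_finsetSum _ fun x _ =>
      MeasureTheory.integrable_finsetSum _ fun y _ => hint x y] at hE
  simp only [MeasureTheory.integral_const, MeasureTheory.probReal_univ, one_smul] at hE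
  have hE2 : ∀ x : Finset ι, ∫ ω, ∑ y : Finset ι,
      {ω | acc ω x y = true}.indicator (fun _ => disjWeight m x y) ω ∂μ =
      ∑ y : Finset ι, μ.real {ω | acc ω x y = true} * disjWeight m x y := by
    intro x
    rw [MeasureTheory.integral_finsetSum _ fun y _ => hint x y]
    refine sum_congr rfl fun y _ => ?_
    rw [MeasureTheory.integral_indicator_const _ (hmeas x y), smul_eq_mul]
  simp only [hE2] at hE
  have hup := sum_mul_disjWeight_le hι (fun x y => μ.real {ω | acc ω x y = true}) hdisj hmeet
  have hW : (0 : ℝ) < #(splits ι m) * 4 ^ m := by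
    have := splits_card_pos hι
    positivity
  have hfin : (#(splits ι m) * 4 ^ m : ℝ) * (31 / 500) ≤ (#(splits ι m) * 4 ^ m : ℝ) *
      (36 / 25 * (Real.exp (-((m + 1 : ℝ) / 512)) * (Fintype.card M : ℝ) ^ (2 * p))) := by
    rw [hδ] at hE
    linarith
  have := le_of_mul_le_mul_left hfin hW
  linarith

end Disjointness

/-! ### Clusterings without disagreement -/

section Clustering

open Finset

theorem minDisagree_eq_zero_iff {n : ℕ} {w : KEdge n → ℤ} (hw : ∀ e, w e = -1 ∨ w e = 1) :
    minDisagree w = 0 ↔ ∃ C : Clustering n, ∀ e, EdgeAgrees w C e := by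
  classical
  have hzero : ∀ C : Clustering n, disagree w C = 0 ↔ ∀ e, EdgeAgrees w C e := by
    intro C
    have h1 : disagree w C = ∑ e : KEdge n with ¬ EdgeAgrees w C e, |w e| := by
      unfold disagree agree
      rw [sub_eq_iff_eq_add, add_comm]
      convert (sum_filter_add_sum_filter_not univ (fun e => EdgeAgrees w C e) fun e => |w e|).symm
    rw [h1, sum_eq_zero_iff_of_nonneg fun e _ => abs_nonneg _]
    refine ⟨fun h e => ?_, fun h e he => absurd (h e) (mem_filter.1 he).2⟩
    by_contra he
    have := abs_eq_zero.1 (h e (mem_filter.2 ⟨mem_univ _, he⟩))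
    rcases hw e with h | h <;> omega
  have hmin := minDisagree_isLeast w
  constructor
  · intro h
    obtain ⟨C, hC⟩ := hmin.1
    exact ⟨C, (hzero C).1 (hC.trans h)⟩
  · rintro ⟨C, hC⟩
    obtain ⟨C', hC'⟩ := hmin.1
    exact le_antisymm (hmin.2 ⟨C, (hzero C).2 hC⟩) (hC' ▸ disagree_nonneg w C')

theorem sameCluster_mk_iff {n : ℕ} (C : Clustering n) {u v : Fin n}
    (h : ¬ (s(u, v) : Sym2 (Fin n)).IsDiag) : SameCluster C ⟨s(u, v), h⟩ ↔ u ∈ C.part v := by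
  rw [Finpartition.mem_part_iff_exists]
  simp [SameCluster]

/-! ### Set disjointness as a clustering problem -/

variable {ι : Type*} {n : ℕ} (f : ι × Fin 3 ↪ Fin n)

open Classical in
/-- The weighted graph on triples of nodes `a i, b i, c i = f (i, 0), f (i, 1), f (i, 2)` and
perhaps further nodes in which `a i, c i` are joined positively for `i ∈ x` and `b i, c i` for
`i ∈ y`, and all other edges are negative. -/
noncomputable def tripleGraph (x y : Finset ι) (e : KEdge n) : ℤ :=
  if (∃ i ∈ x, e.1 = s(f (i, 0), f (i, 2))) ∨ (∃ i ∈ y, e.1 = s(f (i, 1), f (i, 2)))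
  then 1 else -1

theorem tripleGraph_eq (x y : Finset ι) (e : KEdge n) :
    tripleGraph f x y e = -1 ∨ tripleGraph f x y e = 1 := by
  unfold tripleGraph
  split_ifs <;> simp

open Classical in
/-- A name for the cluster of each node: that of `c i` for the nodes joined to `c i`. -/
noncomputable def tripleLabel (x y : Finset ι) : Fin n → Fin n :=
  Function.extend f
    (fun a => if (a.2 = 0 ∧ a.1 ∈ x) ∨ (a.2 = 1 ∧ a.1 ∈ y) then f (a.1, 2) else f a) id

theorem tripleLabel_cases (x y : Finset ι) (v : Fin n) :
    tripleLabel f x y v = v ∨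
      (∃ i ∈ x, v = f (i, 0) ∧ tripleLabel f x y v = f (i, 2)) ∨
      (∃ i ∈ y, v = f (i, 1) ∧ tripleLabel f x y v = f (i, 2)) := by
  by_cases hv : ∃ a, f a = v
  · obtain ⟨⟨i, r⟩, rfl⟩ := hv
    unfold tripleLabel
    rw [f.injective.extend_apply]
    split_ifs with h
    · rcases h with ⟨h1, h2⟩ | ⟨h1, h2⟩ <;> simp only at h1 h2 <;> subst h1
      · exact Or.inr (Or.inl ⟨i, h2, rfl, rfl⟩)
      · exact Or.inr (Or.inr ⟨i, h2, rfl, rfl⟩)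
    · exact Or.inl rfl
  · exact Or.inl (Function.extend_apply' _ _ _ hv)

theorem tripleLabel_eq_iff {x y : Finset ι} (hxy : Disjoint x y) {u v : Fin n} (huv : u ≠ v) :
    tripleLabel f x y u = tripleLabel f x y v ↔
      (∃ i ∈ x, s(u, v) = s(f (i, 0), f (i, 2))) ∨ (∃ i ∈ y, s(u, v) = s(f (i, 1), f (i, 2))) := by
  constructor
  · intro h
    rcases tripleLabel_cases f x y u with hu | ⟨i, hi, hu, hu'⟩ | ⟨i, hi, hu, hu'⟩ <;>
    rcases tripleLabel_cases f x y v with hv | ⟨j, hj, hv, hv'⟩ | ⟨j, hj, hv, hv'⟩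
    · exact absurd (hu.symm.trans (h.trans hv)) huv
    · exact Or.inl ⟨j, hj, by rw [← hv, ← hv', ← h, hu, Sym2.eq_swap]⟩
    · exact Or.inr ⟨j, hj, by rw [← hv, ← hv', ← h, hu, Sym2.eq_swap]⟩
    · exact Or.inl ⟨i, hi, by rw [← hu, ← hu', h, hv]⟩
    · rw [hu', hv'] at h
      have := congrArg Prod.fst (f.injective h)
      simp only at this
      exact absurd (by rw [hu, hv, this]) huv
    · rw [hu', hv'] at h
      have := congrArg Prod.fst (f.injective h)
      simp only at this
      exact absurd (this ▸ hj) (disjoint_left.1 hxy hi)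
    · exact Or.inr ⟨i, hi, by rw [← hu, ← hu', h, hv]⟩
    · rw [hu', hv'] at h
      have := congrArg Prod.fst (f.injective h)
      simp only at this
      exact absurd (this ▸ hi) (disjoint_left.1 hxy hj)
    · rw [hu', hv'] at h
      have := congrArg Prod.fst (f.injective h)
      simp only at this
      exact absurd (by rw [hu, hv, this]) huv
  · have h2 : ∀ i, tripleLabel f x y (f (i, 2)) = f (i, 2) := fun i => by
      simp [tripleLabel, f.injective.extend_apply]
    have h0 : ∀ i ∈ x, tripleLabel f x y (f (i, 0)) = f (i, 2) := fun i hi => by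
      simp [tripleLabel, f.injective.extend_apply, hi]
    have h1 : ∀ i ∈ y, tripleLabel f x y (f (i, 1)) = f (i, 2) := fun i hi => by
      simp [tripleLabel, f.injective.extend_apply, hi]
    rintro (⟨i, hi, h⟩ | ⟨i, hi, h⟩) <;>
      rcases Sym2.eq_iff.1 h with ⟨rfl, rfl⟩ | ⟨rfl, rfl⟩ <;>
      simp only [h2, h0 i, h1 i, hi]

/-- The triple graph splits into positive cliques if and only if no `c i` is joined to both `a i`
and `b i`. -/
theorem minDisagree_tripleGraph_eq_zero_iff (x y : Finset ι) :
    minDisagree (tripleGraph f x y) = 0 ↔ Disjoint x y := by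
  classical
  rw [minDisagree_eq_zero_iff (tripleGraph_eq f x y)]
  constructor
  · rintro ⟨C, hC⟩
    rw [disjoint_left]
    intro i hx hy
    have hne : ∀ r t : Fin 3, r ≠ t → ¬ (s(f (i, r), f (i, t)) : Sym2 (Fin n)).IsDiag := by
      intro r t hrt h
      exact hrt (congrArg Prod.snd (f.injective (Sym2.mk_isDiag_iff.1 h)))
    have hac := hC ⟨s(f (i, 0), f (i, 2)), hne 0 2 (by decide)⟩
    have hbc := hC ⟨s(f (i, 1), f (i, 2)), hne 1 2 (by decide)⟩
    have hab := hC ⟨s(f (i, 0), f (i, 1)), hne 0 1 (by decide)⟩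
    have wac : tripleGraph f x y ⟨s(f (i, 0), f (i, 2)), hne 0 2 (by decide)⟩ = 1 :=
      if_pos (Or.inl ⟨i, hx, rfl⟩)
    have wbc : tripleGraph f x y ⟨s(f (i, 1), f (i, 2)), hne 1 2 (by decide)⟩ = 1 :=
      if_pos (Or.inr ⟨i, hy, rfl⟩)
    have wab : tripleGraph f x y ⟨s(f (i, 0), f (i, 1)), hne 0 1 (by decide)⟩ = -1 := by
      refine if_neg ?_
      rintro (⟨j, -, h⟩ | ⟨j, -, h⟩) <;> simp at h
    unfold EdgeAgrees at hac hbc hab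
    rw [wac, sameCluster_mk_iff] at hac
    rw [wbc, sameCluster_mk_iff] at hbc
    rw [wab, sameCluster_mk_iff] at hab
    norm_num at hac hbc hab
    have e1 := C.mem_part_iff_exists.1 hac
    have e2 := C.mem_part_iff_exists.1 hbc
    obtain ⟨P, hP, h1, h2⟩ := e1
    obtain ⟨Q, hQ, h3, h4⟩ := e2
    obtain rfl := C.eq_of_mem_parts hP hQ h2 h4
    exact hab (C.mem_part_iff_exists.2 ⟨P, hP, h1, h3⟩)
  · intro hxy
    refine ⟨Finpartition.ofSetoid (Setoid.ker (tripleLabel f x y)), ?_⟩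
    rintro ⟨e, he⟩
    induction e with
    | _ u v =>
      have huv : u ≠ v := fun h => he (Sym2.mk_isDiag_iff.2 h)
      unfold EdgeAgrees
      rw [sameCluster_mk_iff, Finpartition.mem_part_ofSetoid_iff_rel, Setoid.ker_def,
        eq_comm, tripleLabel_eq_iff f hxy huv]
      unfold tripleGraph
      split_ifs with h
      · exact Or.inl ⟨one_pos, h⟩
      · exact Or.inr ⟨by norm_num, h⟩

/-! ### From streaming algorithms to protocols -/

/-- The edges `b i, c i`, whose weights encode the set `y`. -/
def IsSecondEdge (e : KEdge n) : Prop := ∃ i, e.1 = s(f (i, 1), f (i, 2))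

theorem tripleGraph_of_not_isSecondEdge (x y : Finset ι) {e : KEdge n} (he : ¬ IsSecondEdge f e) :
    tripleGraph f x y e = tripleGraph f x ∅ e := by
  have : ¬ ∃ i ∈ y, e.1 = s(f (i, 1), f (i, 2)) := fun ⟨i, _, h⟩ => he ⟨i, h⟩
  simp [tripleGraph, this]

theorem tripleGraph_of_isSecondEdge (x y : Finset ι) {e : KEdge n} (he : IsSecondEdge f e) :
    tripleGraph f x y e = tripleGraph f ∅ y e := by
  obtain ⟨i, hi⟩ := he
  have : ¬ ∃ j ∈ x, e.1 = s(f (j, 0), f (j, 2)) := by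
    rintro ⟨j, _, h⟩
    rw [hi] at h
    simp at h
  simp only [tripleGraph, this, notMem_empty, false_and, exists_false]

open Classical in
/-- The part of the stream that depends on `x` only. -/
noncomputable def firstStream (x : Finset ι) : List (KEdge n × ℤ) :=
  ({e : KEdge n | ¬ IsSecondEdge f e} : Finset (KEdge n)).toList.map
    fun e => (e, tripleGraph f x ∅ e)

open Classical in
/-- The part of the stream that depends on `y` only. -/
noncomputable def secondStream (y : Finset ι) : List (KEdge n × ℤ) :=
  ({e : KEdge n | IsSecondEdge f e} : Finset (KEdge n)).toList.map
    fun e => (e, tripleGraph f ∅ y e)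

theorem isStreamOf_tripleGraph (x y : Finset ι) :
    IsStreamOf (firstStream f x ++ secondStream f y) (tripleGraph f x y) := by
  classical
  refine ⟨({e : KEdge n | ¬ IsSecondEdge f e} : Finset (KEdge n)).toList ++
    ({e : KEdge n | IsSecondEdge f e} : Finset (KEdge n)).toList, ?_, ?_, ?_⟩
  · rw [List.nodup_append']
    refine ⟨nodup_toList _, nodup_toList _, ?_⟩
    intro e h1 h2
    simp only [mem_toList, mem_filter] at h1 h2
    exact h1.2 h2.2
  · intro e
    simp only [List.mem_append, mem_toList, mem_filter, mem_univ, true_and]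
    exact (em _).symm
  · rw [List.map_append]
    unfold firstStream secondStream
    congr 1
    · refine List.map_congr_left fun e he => ?_
      simp only [mem_toList, mem_filter] at he
      rw [tripleGraph_of_not_isSecondEdge f x y he.2]
    · refine List.map_congr_left fun e he => ?_
      simp only [mem_toList, mem_filter] at he
      rw [tripleGraph_of_isSecondEdge f x y he.2]

theorem firstStream_length (x x' : Finset ι) :
    (firstStream f x).length = (firstStream f x').length := by
  simp [firstStream]

/-- A streaming algorithm that tests `min-disagree = 0` on the triple graphs yields a protocol for
set disjointness in which the memory content is the message. -/
theorem exp_le_of_testsMinDisagreeZero {ι : Type*} [DecidableEq ι] [Fintype ι] {n : ℕ}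
    (f : ι × Fin 3 ↪ Fin n) {m p s : ℕ} (hι : Fintype.card ι = 2 * m + 1)
    {Ω : Type*} [MeasurableSpace Ω] (μ : MeasureTheory.Measure Ω)
    [MeasureTheory.IsProbabilityMeasure μ] (A : Ω → StreamAlg p s (KEdge n × ℤ))
    (hA : TestsMinDisagreeZero μ A) :
    31 / 720 ≤ Real.exp (-((m + 1 : ℝ) / 512)) * (2 : ℝ) ^ (2 * (p * s)) := by
  have hmeas : ∀ x y, MeasurableSet
      {ω | (A ω).run (firstStream f x ++ secondStream f y) = true} := fun x y =>
    hA.1 _ (measurableSet_singleton true)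
  have hcor := fun x y => hA.2 (tripleGraph f x y) _ (tripleGraph_eq f x y)
    (isStreamOf_tripleGraph f x y)
  simp only [minDisagree_tripleGraph_eq_zero_iff] at hcor
  have key := disjointness_lower_bound (ι := ι) (m := m) (p := p) hι (M := Memory s) μ
    (fun ω i m' x => (firstStream f x).zipIdx.foldl (fun m'' z => (A ω).update i z.2 m'' z.1) m')
    (fun ω i m' y => ((secondStream f y).zipIdx (firstStream f ∅).length).foldl
      (fun m'' z => (A ω).update i z.2 m'' z.1) m')
    (fun ω => (A ω).init) (fun ω => (A ω).output)
    (fun ω x y => (A ω).run (firstStream f x ++ secondStream f y)) ?_ hmeas ?_ ?_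
  · have hcard : (Fintype.card (Memory s) : ℝ) = 2 ^ s := by simp
    rw [hcard, ← pow_mul] at key
    convert key using 3
    ring
  · intro ω x y
    unfold StreamAlg.run StreamAlg.runPass
    congr 2
    funext m' i
    rw [List.zipIdx_append, List.foldl_append, Nat.zero_add, firstStream_length f x ∅]
  · intro x y hxy
    simpa [hxy] using hcor x y
  · intro x y hxy
    have h := hcor x y
    have hc := MeasureTheory.probReal_compl_eq_one_sub (μ := μ) (hmeas x y)
    have he : {ω | (A ω).run (firstStream f x ++ secondStream f y) = true ↔ Disjoint x y} =
        {ω | (A ω).run (firstStream f x ++ secondStream f y) = true}ᶜ := by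
      ext ω
      simp [hxy]
    rw [he, hc] at h
    linarith

end Clustering

/-! ### The space lower bound -/

theorem mainTheorem10 :
    ∃ c : ℝ, 0 < c ∧ ∃ N : ℕ, ∀ n p s : ℕ, N ≤ n → 1 ≤ p →
      ∀ (Ω : Type*) [MeasurableSpace Ω] (μ : MeasureTheory.Measure Ω)
        [MeasureTheory.IsProbabilityMeasure μ] (A : Ω → StreamAlg p s (KEdge n × ℤ)),
        TestsMinDisagreeZero μ A → c * ((n : ℝ) / (p : ℝ)) ≤ (s : ℝ) := by
  refine ⟨1 / 24576, by norm_num, 49152, ?_⟩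
  intro n p s hn hp Ω _ μ _ A hA
  -- The `2 m + 1` disjoint triples use `6 m + 3 ≤ n` nodes.
  obtain ⟨m, hm⟩ : ∃ m, n / 6 = m + 1 := ⟨n / 6 - 1, by omega⟩
  have hcard : Fintype.card (Fin (2 * m + 1) × Fin 3) ≤ Fintype.card (Fin n) := by
    simp only [Fintype.card_prod, Fintype.card_fin]
    omega
  obtain ⟨f⟩ := Function.Embedding.nonempty_of_card_le hcard
  have key := exp_le_of_testsMinDisagreeZero f (m := m) (by simp) μ A hA
  have h2 : (2 : ℝ) ^ (2 * (p * s)) ≤ Real.exp (2 * (p * s)) := by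
    have h1 : (2 : ℝ) ≤ Real.exp 1 := by have := Real.add_one_le_exp (1 : ℝ); linarith
    have h3 : Real.exp (2 * (p * s)) = Real.exp 1 ^ (2 * (p * s)) := by
      rw [← Real.exp_nat_mul]; push_cast; congr 1; ring
    rw [h3]
    gcongr
  have h4 : Real.exp (-4) ≤ 31 / 720 := by
    have h1 : (2.7 : ℝ) ≤ Real.exp 1 := by have := Real.exp_one_gt_d9; linarith
    have h3 : Real.exp 4 = Real.exp 1 ^ 4 := by rw [← Real.exp_nat_mul]; norm_num
    have h5 : (2.7 : ℝ) ^ 4 ≤ Real.exp 4 := by rw [h3]; gcongr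
    rw [Real.exp_neg, inv_le_comm₀ (Real.exp_pos _) (by norm_num)]
    norm_num at h5 ⊢
    linarith
  have h5 : Real.exp (-4) ≤ Real.exp (-((m + 1 : ℝ) / 512) + 2 * (p * s)) := by
    rw [Real.exp_add]
    exact h4.trans (key.trans (by gcongr))
  have h6 := Real.exp_le_exp.1 h5
  have hm' : (n : ℝ) ≤ 12 * (m + 1) := by
    have : n ≤ 12 * (m + 1) := by omega
    exact_mod_cast this
  have hn' : (49152 : ℝ) ≤ n := by exact_mod_cast hn
  have hp' : (0 : ℝ) < p := by exact_mod_cast hp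
  rw [mul_div_assoc', div_le_iff₀ hp']
  linarith
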